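/- Conventions. All Hilbert spaces are complex, with inner products $(\cdot,\cdot)$ linear in the first entry; $\mathcal B(\mathcal G)$ denotes the bounded everywhere defined operators on $\mathcal G$ and $D(z_0;\varepsilon)$ the open disc. For a closed operator $T$, $z\in\rho(T)$ means that $T-zI$ is bijective from $\mathrm{dom}(T)$ onto the whole space with bounded inverse. The discrete spectrum $\sigma_d(T)$ consists of the eigenvalues $z_0$ of $T$ that are isolated in the spectrum $\sigma(T)=\mathbb C\setminus\rho(T)$ and have finite algebraic multiplicity, i.e. the Riesz projection $P(z_0;T)=-\frac1{2\pi i}\oint_{|\zeta-z_0|=r}(T-\zeta I)^{-1}\,d\zeta$ ($r>0$ small) has finite rank. A $\mathcal B(\mathcal G)$-valued function $F$ is finitely meromorphic at $w$ if on some punctured disc around $w$ it has a norm convergent Laurent expansion $F(z)=\sum_{k=-N}^{\infty}(z-w)^kF_k$ with $N\in\mathbb N_0$, $F_k\in\mathcal B(\mathcal G)$, and $F_k$ of finite rank for $-N\le k\le -1$; it is finitely meromorphic on an open set $\Omega$ if it is meromorphic on $\Omega$ and finitely meromorphic at each of its poles in $\Omega$. Setting. Let $\mathfrak H$ be a separable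 complex Hilbert space and let $B_1,B_2$ be densely defined closed operators in $\mathfrak H$ with $\rho(B_1)\cap\rho(B_2)\neq\emptyset$. Let $S=B_1\cap B_2$ be their common restriction to $\{f\in\mathrm{dom}(B_1)\cap\mathrm{dom}(B_2) : B_1f=B_2f\}$, and assume that $S$ is densely defined and symmetric with equal deficiency indices. Let $A_0$ be a self-adjoint extension of $S$ such that $$S=A_0\cap B_1=A_0\cap B_2=A_0\cap B_1^*=A_0\cap B_2^*.$$ Let $\{\mathcal G,\Gamma_0,\Gamma_1\}$ be a boundary triple for $S^*$, that is, $\mathcal G$ is a Hilbert space and $\Gamma_0,\Gamma_1:\mathrm{dom}(S^*)\to\mathcal G$ are linear maps such that $(S^*f,g)-(f,S^*g)=(\Gamma_1f,\Gamma_0g)-(\Gamma_0f,\Gamma_1g)$ for all $f,g\in\mathrm{dom}(S^*)$ and $f\mapsto(\Gamma_0f,\Gamma_1f)$ maps $\mathrm{dom}(S^*)$ onto $\mathcal G\times\mathcal G$. Let $\Theta_1,\Theta_2$ be densely defined closed operators in $\mathcal G$, and assume that $A_0=S^*\upharpoonright\ker(\Gamma_0)$ and $$B_j=S^*\upharpoonright\ker(\Gamma_1-\Theta_j\Gamma_0),\qquad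 B_j^*=S^*\upharpoonright\ker(\Gamma_1-\Theta_j^*\Gamma_0),\qquad j=1,2.$$ Let $M(z)=\Gamma_1\bigl(\Gamma_0\upharpoonright\ker(S^*-zI)\bigr)^{-1}$, $z\in\rho(A_0)$, be the corresponding Weyl--Titchmarsh function. Proposition. Assume that $z_0\in\sigma_d(B_j)\cup\rho(B_j)$ for $j=1,2$ and $z_0\in\sigma_d(A_0)\cup\rho(A_0)$. Then there exists $\varepsilon_0>0$ such that $D(z_0;\varepsilon_0)\setminus\{z_0\}\subset\rho(A_0)$ and, for $j=1,2$, the operator $\Theta_j-M(z)$ has an inverse $(\Theta_j-M(z))^{-1}\in\mathcal B(\mathcal G)$ for every $z\in D(z_0;\varepsilon_0)\setminus\{z_0\}$, and the function $$z\mapsto\bigl(\Theta_j-M(z)\bigr)^{-1}\in\mathcal B(\mathcal G)$$ is analytic on $D(z_0;\varepsilon_0)\setminus\{z_0\}$ and finitely meromorphic on $D(z_0;\varepsilon_0)$. -/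

import Mathlib

open scoped Topology

noncomputable section

namespace WeylExt

/-! ### Closed operators: bounded inverses, resolvent set, discrete spectrum -/

section Operators

variable {E : Type*} [NormedAddCommGroup E] [InnerProductSpace ℂ E]

/-- The everywhere defined operator `z I`, as a partially defined operator. -/
def scalarOp (E : Type*) [NormedAddCommGroup E] [InnerProductSpace ℂ E] (z : ℂ) : E →ₗ.[ℂ] E :=
  (z • (LinearMap.id : E →ₗ[ℂ] E)).toPMap ⊤

/-- `R` is the inverse of the (possibly unbounded) operator `T`, and `R` is bounded and everywhere
defined: the graph of `T` is `{(R y, y)}`. -/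
def IsBoundedInverse (T : E →ₗ.[ℂ] E) (R : E →L[ℂ] E) : Prop :=
  ∀ x y : E, (x, y) ∈ T.graph ↔ R y = x

/-- `T` is injective and onto, with an inverse in `𝓑(E)`. -/
def BoundedlyInvertible (T : E →ₗ.[ℂ] E) : Prop :=
  ∃ R : E →L[ℂ] E, IsBoundedInverse T R

open scoped Classical in
/-- The inverse of a boundedly invertible operator as an element of `𝓑(E)`
(and `0` if `T` is not boundedly invertible). -/
def boundedInverse (T : E →ₗ.[ℂ] E) : E →L[ℂ] E :=
  if h : BoundedlyInvertible T then h.choose else 0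

/-- The resolvent set `ρ(T)`. -/
def resolventSet (T : E →ₗ.[ℂ] E) : Set ℂ :=
  {z | BoundedlyInvertible (T - scalarOp E z)}

/-- The resolvent `(T - z I)⁻¹ ∈ 𝓑(E)`, for `z ∈ ρ(T)`. -/
def resolvent (T : E →ₗ.[ℂ] E) (z : ℂ) : E →L[ℂ] E :=
  boundedInverse (T - scalarOp E z)

/-- The Riesz projection `-(2πi)⁻¹ ∮ (T - ζ I)⁻¹ dζ`, the integral being over the counterclockwise
circle with centre `z₀` and radius `r`. -/
def rieszProjection (T : E →ₗ.[ℂ] E) (z₀ : ℂ) (r : ℝ) : E →L[ℂ] E :=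
  -((2 * (Real.pi : ℂ) * Complex.I)⁻¹ • ∮ ζ in C(z₀, r), resolvent T ζ)

/-- Bounded operators of finite rank. -/
def IsFiniteRank (R : E →L[ℂ] E) : Prop :=
  FiniteDimensional ℂ (LinearMap.range (R : E →ₗ[ℂ] E))

/-- The discrete spectrum `σ_d(T)`: eigenvalues which are isolated in the spectrum and have
finite algebraic multiplicity, the algebraic eigenspace at an isolated point `z₀` of the spectrum
being the range of the Riesz projection for a circle around `z₀` that encloses no other point of
the spectrum. -/
def discreteSpectrum (T : E →ₗ.[ℂ] E) : Set ℂ :=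
  {z₀ | (∃ x : T.domain, (x : E) ≠ 0 ∧ T x = z₀ • (x : E)) ∧
    ∃ r : ℝ, 0 < r ∧ Metric.closedBall z₀ r \ {z₀} ⊆ resolventSet T ∧
      IsFiniteRank (rieszProjection T z₀ r)}

end Operators

/-! ### Finitely meromorphic operator-valued functions -/

section Meromorphic

variable {E : Type*} [NormedAddCommGroup E] [InnerProductSpace ℂ E]

/-- `F` is finitely meromorphic at `z₀`: on a punctured disc it is the sum of a norm convergent
Laurent series `F z = ∑_{k ≥ -N} (z - z₀)^k F_k` whose coefficients `F_k` with `-N ≤ k ≤ -1` have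
finite rank. Here `C n` is the coefficient `F_{n - N}`. -/
def FinitelyMeromorphicAt (F : ℂ → E →L[ℂ] E) (z₀ : ℂ) : Prop :=
  ∃ ε : ℝ, 0 < ε ∧ ∃ (N : ℕ) (C : ℕ → E →L[ℂ] E),
    (∀ n < N, IsFiniteRank (C n)) ∧
    ∀ z ∈ Metric.ball z₀ ε \ {z₀}, HasSum (fun n : ℕ => (z - z₀) ^ ((n : ℤ) - (N : ℤ)) • C n) (F z)

/-- `F` is finitely meromorphic on `Ω`: it is meromorphic on `Ω` and finitely meromorphic at each
of its poles in `Ω`. -/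
def FinitelyMeromorphicOn (F : ℂ → E →L[ℂ] E) (Ω : Set ℂ) : Prop :=
  MeromorphicOn F Ω ∧ ∀ w ∈ Ω, meromorphicOrderAt F w < 0 → FinitelyMeromorphicAt F w

end Meromorphic

/-! ### Boundary triples and Weyl--Titchmarsh functions -/

section Triples

open scoped LinearPMap

variable {H : Type*} [NormedAddCommGroup H] [InnerProductSpace ℂ H]

/-- The restriction `T ↾ N` of `T` to a subspace `N` of its domain. -/
def restrict (T : H →ₗ.[ℂ] H) (N : Submodule ℂ T.domain) : H →ₗ.[ℂ] H :=
  T.domRestrict (N.map T.domain.subtype)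

/-- `ker (T - z I)`, as a subspace of the domain of `T`. -/
def eigenKer (T : H →ₗ.[ℂ] H) (z : ℂ) : Submodule ℂ T.domain :=
  LinearMap.ker (T.toFun - z • T.domain.subtype)

variable [CompleteSpace H]

/-- A boundary triple `{G, Γ₀, Γ₁}` for `S*`. (The inner product of Mathlib is linear in the second
entry.) -/
structure BoundaryTriple (S : H →ₗ.[ℂ] H) (G : Type*) [NormedAddCommGroup G]
    [InnerProductSpace ℂ G] where
  Γ₀ : S†.domain →ₗ[ℂ] G
  Γ₁ : S†.domain →ₗ[ℂ] G
  green : ∀ f g : S†.domain,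
    inner ℂ (g : H) (S† f) - inner ℂ (S† g) (f : H)
      = inner ℂ (Γ₀ g) (Γ₁ f) - inner ℂ (Γ₁ g) (Γ₀ f)
  surjective : Function.Surjective fun f : S†.domain => (Γ₀ f, Γ₁ f)

namespace BoundaryTriple

variable {S : H →ₗ.[ℂ] H} {G : Type*} [NormedAddCommGroup G] [InnerProductSpace ℂ G]

/-- `S* ↾ ker Γ₀`. -/
def baseExtension (bt : BoundaryTriple S G) : H →ₗ.[ℂ] H :=
  restrict S† (LinearMap.ker bt.Γ₀)

/-- `S* ↾ ker (Γ₁ - Θ Γ₀)`: the domain consists of the `f ∈ dom S*` with `Γ₀ f ∈ dom Θ` and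
`Θ Γ₀ f = Γ₁ f`. -/
def extension (bt : BoundaryTriple S G) (Θ : G →ₗ.[ℂ] G) : H →ₗ.[ℂ] H :=
  restrict S† (Θ.graph.comap (bt.Γ₀.prod bt.Γ₁))

/-- The `γ`-field `γ(z) = (Γ₀ ↾ ker (S* - z I))⁻¹`, with values in `dom S*`. -/
def gammaField (bt : BoundaryTriple S G) (z : ℂ) : G →ₗ.[ℂ] S†.domain :=
  (bt.Γ₀.toPMap (eigenKer S† z)).inverse

/-- The Weyl--Titchmarsh function `M(z) = Γ₁ (Γ₀ ↾ ker (S* - z I))⁻¹`. For `z` in the resolvent set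
of `S* ↾ ker Γ₀`, the inverse exists and `M(z)` is defined on all of `G`. -/
def weylM (bt : BoundaryTriple S G) (z : ℂ) : G →ₗ.[ℂ] G :=
  bt.Γ₁.compPMap (bt.gammaField z)

end BoundaryTriple

/-- The standing assumptions on the closed operators `B 0`, `B 1`, on their intersection
`S = B 0 ∩ B 1` (the common restriction of both operators to
`{f ∈ dom (B 0) ∩ dom (B 1) | B 0 f = B 1 f}`), and on the self-adjoint operator `A₀`. -/
structure Setting (B : Fin 2 → H →ₗ.[ℂ] H) (S A₀ : H →ₗ.[ℂ] H) : Prop where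
  dense_B : ∀ j, Dense ((B j).domain : Set H)
  closed_B : ∀ j, (B j).IsClosed
  nonempty_resolventSet : (resolventSet (B 0) ∩ resolventSet (B 1)).Nonempty
  S_eq : S = B 0 ⊓ B 1
  dense_S : Dense (S.domain : Set H)
  symmetric_S : S.IsFormalAdjoint S
  /-- Equal deficiency indices: `ker (S* - i)` and `ker (S* + i)` have equal Hilbert dimension. -/
  deficiency : Nonempty
    ((eigenKer S† Complex.I).map S†.domain.subtype ≃ₗᵢ[ℂ]
      (eigenKer S† (-Complex.I)).map S†.domain.subtype)
  selfAdjoint : IsSelfAdjoint A₀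
  extends_S : S ≤ A₀
  disjoint_B : ∀ j, A₀ ⊓ B j = S
  disjoint_B_adjoint : ∀ j, A₀ ⊓ (B j)† = S

end Triples

end WeylExt

end

open scoped Topology

noncomputable section

namespace WeylExt

/-! ### Resolvents of unbounded operators and Riesz projections. -/

section Resolvents

variable {E : Type*} [NormedAddCommGroup E] [InnerProductSpace ℂ E]

/-! The inverse of `Θ - M(z)` is a resolvent in disguise. Let `A` and `B` be the restrictions of
`S†` belonging to `ker Γ₀` and to `Θ`, and fix `w` near `z₀` in both resolvent sets. For `y` in `G`
choose, boundedly and independently of `z`, `e = (A - w)⁻¹ C y` with `Γ₀ e = 0` and `Γ₁ e = y`. If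
`k = (B - z)⁻¹ (S† - z) e`, then `k - e` lies in `ker (S† - z)`, so `M(z) Γ₀ k = Γ₁ k - y = Θ Γ₀ k -
y`. Hence `Γ₀ k` is the solution of `(Θ - M(z)) x = y`. This is the Krein type formula
`exists_isBoundedInverse_sub_weylM`, in which `z` enters only through `(B - z)⁻¹` and scalar
polynomials; the resolvent of `A` occurs only at `w`, so a pole of `M` at `z₀` does no harm.

It remains to see that `(B - z)⁻¹` is finitely meromorphic at `z₀` (`exists_resolvent_eq`). With `P`
the Riesz projection, the resolvent is an analytic Cauchy integral plus `P (B - z)⁻¹`. The latter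
takes values in the finite dimensional range of `P`, where the resolvent acts as that of a matrix
and is therefore meromorphic. -/

theorem mem_graph_sub_iff {F F' : Type*} [AddCommGroup F] [Module ℂ F] [AddCommGroup F']
    [Module ℂ F'] {T U : F →ₗ.[ℂ] F'} {x : F} {y : F'} :
    (x, y) ∈ (T - U).graph ↔ ∃ a b, (x, a) ∈ T.graph ∧ (x, b) ∈ U.graph ∧ a - b = y := by
  constructor
  · intro h
    obtain ⟨⟨x', hx'⟩, h1, h2⟩ := (LinearPMap.mem_graph_iff _).1 h
    obtain rfl : x' = x := h1
    exact ⟨_, _, T.mem_graph ⟨x', hx'.1⟩, U.mem_graph ⟨x', hx'.2⟩, h2⟩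
  · rintro ⟨a, b, ha, hb, rfl⟩
    obtain ⟨⟨x₁, hx₁⟩, h1, rfl⟩ := (LinearPMap.mem_graph_iff _).1 ha
    obtain ⟨⟨x₂, hx₂⟩, h2, rfl⟩ := (LinearPMap.mem_graph_iff _).1 hb
    obtain rfl : x₁ = x := h1
    obtain rfl : x₂ = x₁ := h2
    exact (T - U).mem_graph ⟨x₂, hx₁, hx₂⟩

theorem mem_graph_sub_scalarOp {T : E →ₗ.[ℂ] E} {z : ℂ} {x y : E} :
    (x, y) ∈ (T - scalarOp E z).graph ↔ (x, y + z • x) ∈ T.graph := by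
  rw [mem_graph_sub_iff]
  constructor
  · rintro ⟨a, b, ha, hb, rfl⟩
    obtain ⟨⟨x', hx'⟩, h1, rfl⟩ := (LinearPMap.mem_graph_iff _).1 hb
    obtain rfl : x' = x := h1
    have : (scalarOp E z) ⟨x', hx'⟩ = z • x' := rfl
    rwa [this, sub_add_cancel]
  · intro h
    exact ⟨_, z • x, h, (scalarOp E z).mem_graph ⟨x, Submodule.mem_top⟩, add_sub_cancel_right _ _⟩

theorem IsBoundedInverse.boundedInverse_eq {T : E →ₗ.[ℂ] E} {R : E →L[ℂ] E}
    (h : IsBoundedInverse T R) : boundedInverse T = R := by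
  have hT : BoundedlyInvertible T := ⟨R, h⟩
  have h' : IsBoundedInverse T (boundedInverse T) := by
    rw [boundedInverse, dif_pos hT]
    exact hT.choose_spec
  ext y
  exact ((h _ y).1 ((h' _ y).2 rfl)).symm

theorem resolvent_apply_eq_iff {T : E →ₗ.[ℂ] E} {z : ℂ} (hz : z ∈ resolventSet T) {x y : E} :
    resolvent T z y = x ↔ (x, y + z • x) ∈ T.graph := by
  obtain ⟨R, hR⟩ := hz
  rw [resolvent, hR.boundedInverse_eq, ← mem_graph_sub_scalarOp]
  exact (hR x y).symm

theorem resolvent_mem_graph {T : E →ₗ.[ℂ] E} {z : ℂ} (hz : z ∈ resolventSet T) (y : E) :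
    (resolvent T z y, y + z • resolvent T z y) ∈ T.graph :=
  (resolvent_apply_eq_iff hz).1 rfl

theorem resolvent_injective {T : E →ₗ.[ℂ] E} {z : ℂ} (hz : z ∈ resolventSet T) :
    Function.Injective (resolvent T z) := by
  rw [injective_iff_map_eq_zero]
  intro y hy
  have h := resolvent_mem_graph hz y
  rw [hy] at h
  simpa using T.graph_fst_eq_zero_snd h rfl

/-- If `(T - z) x = y`, then `(T - w) x = y + (z - w) x`. This vector form of the resolvent identity
moves the spectral parameter throughout. -/
theorem resolvent_apply_add_smul {T : E →ₗ.[ℂ] E} {z w : ℂ} (hz : z ∈ resolventSet T)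
    (hw : w ∈ resolventSet T) (y : E) :
    resolvent T w (y + (z - w) • resolvent T z y) = resolvent T z y := by
  rw [resolvent_apply_eq_iff hw]
  convert! resolvent_mem_graph hz y using 2
  module

/-- The first resolvent identity. -/
theorem resolvent_eq_add {T : E →ₗ.[ℂ] E} {z w : ℂ} (hz : z ∈ resolventSet T)
    (hw : w ∈ resolventSet T) :
    resolvent T z = resolvent T w + (z - w) • (resolvent T w * resolvent T z) := by
  ext y
  conv_lhs => rw [← resolvent_apply_add_smul hz hw y]
  simp

theorem resolvent_commute {T : E →ₗ.[ℂ] E} {z w : ℂ} (hz : z ∈ resolventSet T)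
    (hw : w ∈ resolventSet T) : Commute (resolvent T z) (resolvent T w) := by
  rcases eq_or_ne z w with rfl | hne
  · exact Commute.refl _
  have h1 := resolvent_eq_add hz hw
  have h2 := resolvent_eq_add hw hz
  have h3 : (z - w) • (resolvent T w * resolvent T z) =
      (z - w) • (resolvent T z * resolvent T w) := by
    have e1 : (z - w) • (resolvent T w * resolvent T z) = resolvent T z - resolvent T w :=
      (sub_eq_of_eq_add' h1).symm
    have e2 : (w - z) • (resolvent T z * resolvent T w) = resolvent T w - resolvent T z :=
      (sub_eq_of_eq_add' h2).symm
    rw [e1, ← neg_sub w z, neg_smul, e2, neg_sub]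
  exact (smul_right_injective _ (sub_ne_zero.2 hne) h3).symm

variable [CompleteSpace E]

/-- The equation `(T - z) x = y` is equivalent to `(1 - (z - w) (T - w)⁻¹) x = (T - w)⁻¹ y`, and the
factor on the left is a unit for `z` near `w`. -/
theorem eventually_isBoundedInverse {T : E →ₗ.[ℂ] E} {w : ℂ} (hw : w ∈ resolventSet T) :
    ∀ᶠ z in 𝓝 w, IsBoundedInverse (T - scalarOp E z)
      (Ring.inverse (1 - (z - w) • resolvent T w) * resolvent T w) := by
  have hc : Filter.Tendsto (fun z : ℂ => 1 - (z - w) • resolvent T w) (𝓝 w) (𝓝 1) := by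
    have : Continuous fun z : ℂ => 1 - (z - w) • resolvent T w := by fun_prop
    simpa using this.tendsto w
  filter_upwards [hc (Units.isOpen.mem_nhds (isUnit_one (M := E →L[ℂ] E)))] with z hz x y
  obtain ⟨u, hu⟩ : IsUnit (1 - (z - w) • resolvent T w) := hz
  rw [← hu, Ring.inverse_unit, mem_graph_sub_scalarOp]
  have h1 : (x, y + z • x) ∈ T.graph ↔ resolvent T w (y + (z - w) • x) = x := by
    rw [resolvent_apply_eq_iff hw]
    have : y + (z - w) • x + w • x = y + z • x := by module
    rw [this]
  have h2 : resolvent T w (y + (z - w) • x) = x ↔ (u : E →L[ℂ] E) x = resolvent T w y := by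
    rw [hu, map_add, map_smul]
    change _ ↔ x - (z - w) • resolvent T w x = _
    rw [sub_eq_iff_eq_add, eq_comm]
  rw [h1, h2]
  constructor
  · intro h
    change (↑u⁻¹ : E →L[ℂ] E) (resolvent T w y) = x
    rw [← h]
    exact congrArg (fun A : E →L[ℂ] E => A x) u.inv_mul
  · rintro rfl
    exact congrArg (fun A : E →L[ℂ] E => A (resolvent T w y)) u.mul_inv

theorem isOpen_resolventSet (T : E →ₗ.[ℂ] E) : IsOpen (resolventSet T) :=
  isOpen_iff_eventually.2 fun _ hw =>
    (eventually_isBoundedInverse hw).mono fun _ hz => ⟨_, hz⟩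

theorem analyticAt_resolvent {T : E →ₗ.[ℂ] E} {w : ℂ} (hw : w ∈ resolventSet T) :
    AnalyticAt ℂ (resolvent T) w := by
  have h : AnalyticAt ℂ
      (fun z => Ring.inverse (1 - (z - w) • resolvent T w) * resolvent T w) w := by
    refine AnalyticAt.mul ?_ analyticAt_const
    refine AnalyticAt.fun_comp (g := Ring.inverse) ?_ ?_
    · simpa using analyticAt_inverse (𝕜 := ℂ) (1 : (E →L[ℂ] E)ˣ)
    · exact analyticAt_const.sub ((analyticAt_id.sub analyticAt_const).smul analyticAt_const)
  refine h.congr ?_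
  filter_upwards [eventually_isBoundedInverse hw] with z hz
  exact hz.boundedInverse_eq.symm

theorem _root_.ContinuousLinearMap.circleIntegral_comp_comm {F F' : Type*} [NormedAddCommGroup F]
    [NormedSpace ℂ F] [CompleteSpace F] [NormedAddCommGroup F'] [NormedSpace ℂ F']
    [CompleteSpace F'] (L : F →L[ℂ] F') {f : ℂ → F} {c : ℂ} {r : ℝ} (hf : CircleIntegrable f c r) :
    (∮ z in C(c, r), L (f z)) = L (∮ z in C(c, r), f z) := by
  simp only [circleIntegral]
  rw [← L.intervalIntegral_comp_comm hf.out]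
  simp

section Riesz

variable {T : E →ₗ.[ℂ] E} {z₀ : ℂ} {r : ℝ}

theorem circleIntegrable_resolvent (hr : 0 < r)
    (hT : Metric.closedBall z₀ r \ {z₀} ⊆ resolventSet T) :
    CircleIntegrable (resolvent T) z₀ r :=
  ContinuousOn.circleIntegrable hr.le fun _ hz =>
    (analyticAt_resolvent (hT ⟨Metric.sphere_subset_closedBall hz,
      Metric.ne_of_mem_sphere hz hr.ne'⟩)).continuousAt.continuousWithinAt

theorem rieszProjection_commute_resolvent (hr : 0 < r)
    (hT : Metric.closedBall z₀ r \ {z₀} ⊆ resolventSet T) {z : ℂ} (hz : z ∈ resolventSet T) :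
    Commute (rieszProjection T z₀ r) (resolvent T z) := by
  have hi := circleIntegrable_resolvent hr hT
  have h : Commute (∮ ζ in C(z₀, r), resolvent T ζ) (resolvent T z) := by
    have h1 := (ContinuousLinearMap.mul ℂ (E →L[ℂ] E) (resolvent T z)).circleIntegral_comp_comm hi
    have h2 := ((ContinuousLinearMap.mul ℂ (E →L[ℂ] E)).flip
      (resolvent T z)).circleIntegral_comp_comm hi
    simp only [ContinuousLinearMap.mul_apply', ContinuousLinearMap.flip_apply] at h1 h2
    rw [Commute, SemiconjBy, ← h1, ← h2]
    refine circleIntegral.integral_congr hr.le fun ζ hζ => ?_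
    exact resolvent_commute (hT ⟨Metric.sphere_subset_closedBall hζ,
      Metric.ne_of_mem_sphere hζ hr.ne'⟩) hz
  exact (h.smul_left _).neg_left

/-- The resolvent near an isolated point of the spectrum is the sum of a Cauchy integral and its
product with the Riesz projection. -/
theorem resolvent_eq_cauchy_add_riesz (hr : 0 < r)
    (hT : Metric.closedBall z₀ r \ {z₀} ⊆ resolventSet T) {z : ℂ}
    (hz : z ∈ Metric.ball z₀ r \ {z₀}) :
    resolvent T z = (2 * (Real.pi : ℂ) * Complex.I)⁻¹ •
        (∮ ζ in C(z₀, r), (ζ - z)⁻¹ • resolvent T ζ)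
      + rieszProjection T z₀ r * resolvent T z := by
  have hzT : z ∈ resolventSet T := hT ⟨Metric.ball_subset_closedBall hz.1, hz.2⟩
  have hi := circleIntegrable_resolvent hr hT
  have hne : ∀ ζ ∈ Metric.sphere z₀ r, ζ - z ≠ 0 := by
    rintro ζ hζ h
    rw [sub_eq_zero] at h
    subst h
    exact absurd (Metric.mem_sphere.1 hζ) (Metric.mem_ball.1 hz.1).ne
  have hmem : ∀ ζ ∈ Metric.sphere z₀ r, ζ ∈ resolventSet T := fun ζ hζ =>
    hT ⟨Metric.sphere_subset_closedBall hζ, Metric.ne_of_mem_sphere hζ hr.ne'⟩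
  have hi1 : CircleIntegrable (fun ζ => (ζ - z)⁻¹ • resolvent T ζ) z₀ r :=
    ContinuousOn.circleIntegrable hr.le fun ζ hζ =>
      (((continuousAt_id.sub continuousAt_const).inv₀ (hne ζ hζ)).smul
        (analyticAt_resolvent (hmem ζ hζ)).continuousAt).continuousWithinAt
  have hi2 : CircleIntegrable (fun ζ => resolvent T ζ * resolvent T z) z₀ r :=
    ContinuousOn.circleIntegrable hr.le fun ζ hζ =>
      ((analyticAt_resolvent (hmem ζ hζ)).continuousAt.mul
        continuousAt_const).continuousWithinAt
  -- The resolvent identity, divided by `ζ - z`, is integrated in `ζ`; the constant integrand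
  -- contributes `2πi` times the resolvent at `z`.
  have h1 : (∮ ζ in C(z₀, r), (ζ - z)⁻¹ • resolvent T z) =
      (2 * (Real.pi : ℂ) * Complex.I) • resolvent T z := by
    rw [circleIntegral.integral_smul_const, circleIntegral.integral_sub_inv_of_mem_ball hz.1]
  have h2 : (∮ ζ in C(z₀, r), (ζ - z)⁻¹ • resolvent T z) =
      (∮ ζ in C(z₀, r), (ζ - z)⁻¹ • resolvent T ζ) -
        (∮ ζ in C(z₀, r), resolvent T ζ) * resolvent T z := by
    have h3 := ((ContinuousLinearMap.mul ℂ (E →L[ℂ] E)).flip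
      (resolvent T z)).circleIntegral_comp_comm hi
    simp only [ContinuousLinearMap.mul_apply', ContinuousLinearMap.flip_apply] at h3
    rw [← h3, ← circleIntegral.integral_sub hi1 hi2]
    refine circleIntegral.integral_congr hr.le fun ζ hζ => ?_
    have h4 := resolvent_eq_add hzT (hmem ζ hζ)
    change (ζ - z)⁻¹ • resolvent T z = (ζ - z)⁻¹ • resolvent T ζ - resolvent T ζ * resolvent T z
    conv_lhs => rw [h4]
    rw [smul_add, smul_smul, ← neg_sub ζ z, mul_neg, inv_mul_cancel₀ (hne ζ hζ), neg_one_smul,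
      ← sub_eq_add_neg]
  rw [h1] at h2
  rw [rieszProjection, neg_mul, smul_mul_assoc, ← sub_eq_add_neg, ← smul_sub, ← h2, smul_smul,
    inv_mul_cancel₀ Complex.two_pi_I_ne_zero, one_smul]

end Riesz

end Resolvents

/-! ### Meromorphic operator-valued functions. -/

section Meromorphy

open Filter Polynomial

variable {X Y Z : Type*} [NormedAddCommGroup X] [NormedSpace ℂ X] [NormedAddCommGroup Y]
  [NormedSpace ℂ Y] [NormedAddCommGroup Z] [NormedSpace ℂ Z]

theorem _root_.AnalyticAt.clm_comp {f : ℂ → Y →L[ℂ] Z} {g : ℂ → X →L[ℂ] Y} {z : ℂ}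
    (hf : AnalyticAt ℂ f z) (hg : AnalyticAt ℂ g z) : AnalyticAt ℂ (fun z => f z ∘L g z) z :=
  ((ContinuousLinearMap.compL ℂ X Y Z).analyticAt_bilinear (f z, g z)).fun_comp
    (f := fun z => (f z, g z)) (hf.prod hg)

theorem _root_.MeromorphicAt.clm_comp {f : ℂ → Y →L[ℂ] Z} {g : ℂ → X →L[ℂ] Y} {z : ℂ}
    (hf : MeromorphicAt f z) (hg : MeromorphicAt g z) :
    MeromorphicAt (fun z => f z ∘L g z) z := by
  obtain ⟨k, hk⟩ := hf
  obtain ⟨n, hn⟩ := hg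
  refine ⟨k + n, (hk.clm_comp hn).congr (Eventually.of_forall fun ζ => ?_)⟩
  ext x
  simp [smul_smul, pow_add, mul_comm]

/-- The resolvent of an algebraic element of a normed algebra is meromorphic. -/
theorem meromorphicAt_of_mul_sub_eq_one {A : Type*} [NormedRing A] [NormedAlgebra ℂ A] {D : A}
    (hD : IsIntegral ℂ D) {f : ℂ → A} {z₀ : ℂ}
    (hf : ∀ᶠ z in 𝓝[≠] z₀, f z * (D - algebraMap ℂ A z) = 1) : MeromorphicAt f z₀ := by
  -- The factor `D - z` divides `q(D) - q(z)`, so `f` cancels up to a polynomial in `z` and `D`. For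
  -- a monic `q` annihilating `D` the expression is `-q(z) f(z)`, and the scalar can be divided out
  -- near `z₀`.
  have key : ∀ q : ℂ[X],
      MeromorphicAt (fun z => f z * (aeval D q - algebraMap ℂ A (q.eval z))) z₀ := by
    intro q
    induction q using Polynomial.induction_on with
    | C a => simp
    | add p q hp hq =>
      refine (hp.add hq).congr (Eventually.of_forall fun z => ?_)
      simp only [Pi.add_apply, map_add, eval_add]
      noncomm_ring
    | monomial n a hn =>
      have h1 : MeromorphicAt (fun z : ℂ => algebraMap ℂ A (a * z ^ n)) z₀ := by
        have : AnalyticAt ℂ (fun z : ℂ => (a * z ^ n) • (1 : A)) z₀ := by fun_prop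
        simpa only [Algebra.algebraMap_eq_smul_one] using this.meromorphicAt
      have h2 : MeromorphicAt (fun z => f z * (aeval D (C a * X ^ n) -
          algebraMap ℂ A ((C a * X ^ n).eval z)) * D) z₀ := by
        obtain ⟨k, hk⟩ := hn
        refine ⟨k, ?_⟩
        exact (hk.mul (analyticAt_const (v := D))).congr
          (Eventually.of_forall fun z => smul_mul_assoc _ _ _)
      -- Telescoping: `f(z) (a Dⁿ⁺¹ - a zⁿ⁺¹) = a zⁿ + f(z) (a Dⁿ - a zⁿ) D`.
      refine (h1.add h2).congr ?_
      filter_upwards [hf] with z hz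
      have hc : algebraMap ℂ A (a * z ^ n) =
          f z * (D - algebraMap ℂ A z) * algebraMap ℂ A (a * z ^ n) := by rw [hz, one_mul]
      rw [Pi.add_apply, hc]
      have hcomm : Commute (algebraMap ℂ A (a * z ^ n)) D := Algebra.commutes _ _
      simp only [map_mul, map_pow, aeval_C, aeval_X, eval_mul, eval_C, eval_pow, eval_X, pow_succ]
      simp only [map_mul, map_pow] at hcomm
      have hcz : algebraMap ℂ A z * (algebraMap ℂ A a * algebraMap ℂ A z ^ n) =
          algebraMap ℂ A a * (algebraMap ℂ A z ^ n * algebraMap ℂ A z) := by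
        rw [← map_pow, ← map_mul, ← map_mul, ← map_mul, ← map_mul]
        ring_nf
      rw [mul_assoc (f z), mul_assoc (f z), ← mul_add, sub_mul, sub_mul, hcz, hcomm.eq, mul_assoc]
      congr 1
      abel
  obtain ⟨q, hq, hqD⟩ := hD
  have hne : ∀ᶠ z in 𝓝[≠] z₀, q.eval z ≠ 0 := by
    have hfin : ({z | q.eval z = 0} : Set ℂ).Finite := by
      refine (q.roots.toFinset.finite_toSet).subset fun z hz => ?_
      simpa [hq.ne_zero] using hz
    have := (hfin.subset (Set.sdiff_subset (t := {z₀}))).isClosed.isOpen_compl.mem_nhds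
      (x := z₀) (by simp)
    filter_upwards [mem_nhdsWithin_of_mem_nhds this, self_mem_nhdsWithin] with z hz hz0 h
    exact hz ⟨h, hz0⟩
  have h1 : MeromorphicAt (fun z => (-q.eval z)⁻¹) z₀ := by
    have : AnalyticAt ℂ (fun z => -q.eval z) z₀ := (AnalyticAt.aeval_polynomial analyticAt_id q).neg
    exact this.meromorphicAt.inv
  refine (h1.smul (key q)).congr ?_
  filter_upwards [hne] with z hz
  have : aeval D q = 0 := hqD
  simp only [Pi.smul_apply', this, zero_sub, mul_neg, ← Algebra.commutes, ← Algebra.smul_def]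
  rw [← neg_smul, smul_smul, inv_mul_cancel₀ (neg_ne_zero.2 hz), one_smul]

variable {E : Type*} [NormedAddCommGroup E] [InnerProductSpace ℂ E]

/-- A function which is, near `z₀`, the sum of an analytic one and a meromorphic one that factors
through a fixed operator defined on a finite dimensional space. -/
theorem finitelyMeromorphicAt_of_eventuallyEq {V : Type*} [NormedAddCommGroup V] [NormedSpace ℂ V]
    [FiniteDimensional ℂ V] {F Q : ℂ → E →L[ℂ] E} {m : ℂ → E →L[ℂ] V} (Φ : V →L[ℂ] E) {z₀ : ℂ}
    (hm : MeromorphicAt m z₀) (hQ : AnalyticAt ℂ Q z₀)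
    (hF : ∀ᶠ z in 𝓝[≠] z₀, F z = Φ ∘L m z + Q z) : FinitelyMeromorphicAt F z₀ := by
  obtain ⟨N, p, hp⟩ := hm
  obtain ⟨q, hq⟩ := hQ
  have hp' := hp.eventually_hasSum_sub
  have hq' := hq.eventually_hasSum_sub
  obtain ⟨ε, hε, h⟩ := Metric.eventually_nhds_iff_ball.1
    ((hp'.and hq').and (eventually_nhdsWithin_iff.1 hF))
  -- `p` expands `(z - z₀)^N m(z)`. The Taylor coefficients of `Q` are shifted by `N`, so those of
  -- index below `N` factor through `Φ` alone.
  refine ⟨ε, hε, N, fun n => Φ ∘L p.coeff n + if N ≤ n then q.coeff (n - N) else 0, ?_, ?_⟩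
  · intro n hn
    simp only [if_neg hn.not_ge, add_zero]
    have : LinearMap.range ((Φ ∘L p.coeff n : E →L[ℂ] E) : E →ₗ[ℂ] E) ≤
        LinearMap.range (Φ : V →ₗ[ℂ] E) := LinearMap.range_comp_le_range _ _
    exact Submodule.finiteDimensional_of_le this
  · rintro z ⟨hzε, hz0⟩
    obtain ⟨⟨h1, h2⟩, h3⟩ := h z hzε
    rw [h3 hz0]
    have hne : z - z₀ ≠ 0 := sub_ne_zero.2 hz0
    simp only [FormalMultilinearSeries.apply_eq_pow_smul_coeff] at h1 h2
    have e : ∀ n : ℕ, (z - z₀) ^ ((n : ℤ) - (N : ℤ)) = ((z - z₀) ^ N)⁻¹ * (z - z₀) ^ n := by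
      intro n
      rw [zpow_sub₀ hne, zpow_natCast, zpow_natCast, div_eq_inv_mul]
    have s1 : HasSum (fun n : ℕ => (z - z₀) ^ ((n : ℤ) - (N : ℤ)) • (Φ ∘L p.coeff n))
        (Φ ∘L m z) := by
      have := (h1.const_smul ((z - z₀) ^ N)⁻¹).mapL
        (ContinuousLinearMap.compL ℂ E V E Φ)
      simpa [smul_smul, e, inv_mul_cancel_left₀ (pow_ne_zero N hne),
        inv_mul_cancel₀ (pow_ne_zero N hne)] using this
    have s2 : HasSum (fun n : ℕ => (z - z₀) ^ ((n : ℤ) - (N : ℤ)) •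
        (if N ≤ n then q.coeff (n - N) else 0)) (Q z) := by
      have hinj : Function.Injective fun n : ℕ => n + N := add_left_injective N
      refine (hinj.hasSum_iff ?_).1 ?_
      · intro n hn
        rw [if_neg, smul_zero]
        exact fun h => hn ⟨n - N, Nat.sub_add_cancel h⟩
      · refine h2.congr_fun fun n => ?_
        simp
    simpa only [smul_add] using s1.add s2

end Meromorphy

/-! ### The resolvent near a point of the discrete spectrum. -/

section Riesz

open Filter

variable {E : Type*} [NormedAddCommGroup E] [InnerProductSpace ℂ E] [CompleteSpace E]

theorem eventually_mem_resolventSet {T : E →ₗ.[ℂ] E} {z₀ : ℂ}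
    (hz₀ : z₀ ∈ discreteSpectrum T ∪ resolventSet T) : ∀ᶠ z in 𝓝[≠] z₀, z ∈ resolventSet T := by
  rcases hz₀ with ⟨-, r, hr, hT, -⟩ | hz₀
  · filter_upwards [mem_nhdsWithin_of_mem_nhds (Metric.closedBall_mem_nhds z₀ hr),
      self_mem_nhdsWithin] with z h1 h2 using hT ⟨h1, h2⟩
  · exact mem_nhdsWithin_of_mem_nhds ((isOpen_resolventSet T).mem_nhds hz₀)

/-- Since `P` commutes with the resolvent, its range `V` is invariant and the resolvent on `V` is
that of an endomorphism of a finite dimensional space, which is algebraic. -/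
theorem meromorphicAt_riesz_comp_resolvent {T : E →ₗ.[ℂ] E} {z₀ : ℂ} {r : ℝ} (hr : 0 < r)
    (hT : Metric.closedBall z₀ r \ {z₀} ⊆ resolventSet T)
    (hP : IsFiniteRank (rieszProjection T z₀ r)) :
    MeromorphicAt (fun z => (rieszProjection T z₀ r).rangeRestrict ∘L resolvent T z) z₀ := by
  set P := rieszProjection T z₀ r
  have : FiniteDimensional ℂ (LinearMap.range (P : E →ₗ[ℂ] E)) := hP
  set V := LinearMap.range (P : E →ₗ[ℂ] E)
  have hcomm : ∀ z ∈ resolventSet T, ∀ x, resolvent T z (P x) = P (resolvent T z x) := by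
    intro z hz x
    exact (congrArg (fun A : E →L[ℂ] E => A x)
      (rieszProjection_commute_resolvent hr hT hz).eq).symm
  have hmaps : ∀ z ∈ resolventSet T, ∀ x : V, resolvent T z x ∈ V := by
    rintro z hz ⟨_, x, rfl⟩
    exact ⟨resolvent T z x, (hcomm z hz x).symm⟩
  have hev : ∀ᶠ z in 𝓝[≠] z₀, z ∈ resolventSet T := by
    filter_upwards [mem_nhdsWithin_of_mem_nhds (Metric.closedBall_mem_nhds z₀ hr),
      self_mem_nhdsWithin] with z h1 h2 using hT ⟨h1, h2⟩
  classical
  let RV : ℂ → V →L[ℂ] V := fun z =>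
    if hz : z ∈ resolventSet T then
      ((resolvent T z) ∘L V.subtypeL).codRestrict V (hmaps z hz) else 0
  have hRV : ∀ z (_ : z ∈ resolventSet T) (x : V), (RV z x : E) = resolvent T z x := by
    intro z hz x
    simp only [RV, dif_pos hz]
    rfl
  obtain ⟨w, hw⟩ := hev.exists
  have hinj : Function.Injective (RV w : V →ₗ[ℂ] V) := fun x y hxy =>
    Subtype.ext (resolvent_injective hw (by
      rw [← hRV w hw, ← hRV w hw]
      exact congrArg Subtype.val hxy))
  -- On `V` the inverse of `(T - w)⁻¹` plays the role of `T - w`; adding `w` gives the matrix `D`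
  -- whose resolvent is `RV`.
  let L := LinearEquiv.ofInjectiveEndo (RV w : V →ₗ[ℂ] V) hinj
  let L' : V →L[ℂ] V := LinearMap.toContinuousLinearMap (L.symm : V →ₗ[ℂ] V)
  have hL' : ∀ x, RV w (L' x) = x := fun x => L.apply_symm_apply x
  have hmer : MeromorphicAt RV z₀ := by
    refine meromorphicAt_of_mul_sub_eq_one (D := L' + algebraMap ℂ _ w)
      (Algebra.IsIntegral.isIntegral _) ?_
    filter_upwards [hev] with z hz
    ext x
    have hid := resolvent_apply_add_smul hw hz (L' x : E)
    rw [← hRV w hw, hL'] at hid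
    change (RV z ((L' + algebraMap ℂ _ w - algebraMap ℂ _ z) x) : E) = x
    rw [hRV z hz]
    convert hid using 2
    simp [Algebra.algebraMap_eq_smul_one, sub_smul, add_sub_assoc]
  refine (hmer.clm_comp (MeromorphicAt.const P.rangeRestrict z₀)).congr ?_
  filter_upwards [hev] with z hz
  ext x
  exact (hRV z hz _).trans (hcomm z hz x)

/-- Near a point of the discrete spectrum or of the resolvent set, the resolvent is the sum of an
analytic function and a meromorphic function with values in a fixed finite dimensional space. -/
theorem exists_resolvent_eq {T : E →ₗ.[ℂ] E} {z₀ : ℂ}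
    (hz₀ : z₀ ∈ discreteSpectrum T ∪ resolventSet T) :
    ∃ (V : Submodule ℂ E) (_ : FiniteDimensional ℂ V) (m : ℂ → E →L[ℂ] V) (Q : ℂ → E →L[ℂ] E),
      MeromorphicAt m z₀ ∧ AnalyticAt ℂ Q z₀ ∧
        ∀ᶠ z in 𝓝[≠] z₀, resolvent T z = V.subtypeL ∘L m z + Q z := by
  rcases hz₀ with ⟨-, r, hr, hT, hP⟩ | hz₀
  · refine ⟨_, hP, _, _, meromorphicAt_riesz_comp_resolvent hr hT hP,
      (hasFPowerSeriesOn_cauchy_integral (R := ⟨r, hr.le⟩)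
        (circleIntegrable_resolvent hr hT) hr).analyticAt, ?_⟩
    filter_upwards [mem_nhdsWithin_of_mem_nhds (Metric.ball_mem_nhds z₀ hr),
      self_mem_nhdsWithin] with z h1 h2
    rw [add_comm]
    exact resolvent_eq_cauchy_add_riesz hr hT ⟨h1, h2⟩
  · exact ⟨⊥, inferInstance, 0, resolvent T, MeromorphicAt.const 0 z₀, analyticAt_resolvent hz₀,
      Eventually.of_forall fun z => by ext; simp⟩

end Riesz

/-! ### Closed graph and open mapping arguments in Hilbert space. -/

section BoundedMaps

variable {H G : Type*} [NormedAddCommGroup H] [InnerProductSpace ℂ H] [CompleteSpace H]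
  [NormedAddCommGroup G] [InnerProductSpace ℂ G] [CompleteSpace G]

/-- An everywhere defined operator with an everywhere defined formal adjoint is continuous. -/
theorem continuous_of_forall_exists_inner_eq (f : H →ₗ[ℂ] G)
    (h : ∀ u : G, ∃ v : H, ∀ x, inner ℂ u (f x) = inner ℂ v x) : Continuous f := by
  refine f.continuous_of_seq_closed_graph fun s x y hs hfs => ?_
  refine ext_inner_left ℂ fun u => ?_
  obtain ⟨v, hv⟩ := h u
  refine tendsto_nhds_unique (tendsto_const_nhds.inner hfs) ?_
  simp only [Function.comp_apply, hv]
  exact tendsto_const_nhds.inner hs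

/-- A bounded operator of a Hilbert space onto a Banach space has a bounded right inverse. -/
theorem exists_rightInverse_of_surjective (L : H →L[ℂ] G) (hL : Function.Surjective L) :
    ∃ R : G →L[ℂ] H, ∀ y, L (R y) = y := by
  set K := LinearMap.ker (L : H →ₗ[ℂ] G)
  have : CompleteSpace K := L.isClosed_ker.completeSpace_coe
  let L' : Kᗮ →L[ℂ] G := L ∘L Kᗮ.subtypeL
  have hker : LinearMap.ker (L' : Kᗮ →ₗ[ℂ] G) = ⊥ := by
    rw [LinearMap.ker_eq_bot']
    intro x hx
    have h1 : (x : H) ∈ K := hx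
    have : inner ℂ (x : H) (x : H) = 0 := x.2 x h1
    exact Subtype.ext (inner_self_eq_zero.1 this)
  have hrange : LinearMap.range (L' : Kᗮ →ₗ[ℂ] G) = ⊤ := by
    rw [LinearMap.range_eq_top]
    intro y
    obtain ⟨x, rfl⟩ := hL y
    obtain ⟨k, hk, k', hk', rfl⟩ := K.exists_add_mem_mem_orthogonal x
    refine ⟨⟨k', hk'⟩, ?_⟩
    have : L k = 0 := hk
    change L k' = L (k + k')
    rw [map_add, this, zero_add]
  let e := ContinuousLinearEquiv.ofBijective L' hker hrange
  exact ⟨Kᗮ.subtypeL ∘L (e.symm : G →L[ℂ] Kᗮ), fun y => e.apply_symm_apply y⟩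

end BoundedMaps

/-! ### Boundary triples and the Krein type formula. -/

section Triples

open scoped LinearPMap

variable {H : Type*} [NormedAddCommGroup H] [InnerProductSpace ℂ H]

theorem mem_graph_restrict {T : H →ₗ.[ℂ] H} {N : Submodule ℂ T.domain} {x y : H} :
    (x, y) ∈ (restrict T N).graph ↔ ∃ f : T.domain, f ∈ N ∧ (f : H) = x ∧ T f = y := by
  constructor
  · intro h
    obtain ⟨⟨x', h1, h2⟩, h3, rfl⟩ := (LinearPMap.mem_graph_iff _).1 h
    obtain rfl : x' = x := h3
    obtain ⟨f, hf, hfx⟩ := h1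
    exact ⟨f, hf, hfx, (LinearPMap.domRestrict_apply hfx.symm).symm⟩
  · rintro ⟨f, hf, rfl, rfl⟩
    refine (LinearPMap.mem_graph_iff _).2 ⟨⟨f, ⟨f, hf, rfl⟩, f.2⟩, rfl, ?_⟩
    exact LinearPMap.domRestrict_apply rfl

variable [CompleteSpace H]

namespace BoundaryTriple

variable {S : H →ₗ.[ℂ] H} {G : Type*} [NormedAddCommGroup G] [InnerProductSpace ℂ G]
  (bt : BoundaryTriple S G)

theorem mem_graph_baseExtension {x y : H} :
    (x, y) ∈ bt.baseExtension.graph ↔ ∃ f : S†.domain, bt.Γ₀ f = 0 ∧ (f : H) = x ∧ S† f = y :=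
  mem_graph_restrict

theorem mem_graph_extension {Θ : G →ₗ.[ℂ] G} {x y : H} :
    (x, y) ∈ (bt.extension Θ).graph ↔
      ∃ f : S†.domain, (bt.Γ₀ f, bt.Γ₁ f) ∈ Θ.graph ∧ (f : H) = x ∧ S† f = y :=
  mem_graph_restrict

theorem mem_eigenKer {z : ℂ} {f : S†.domain} : f ∈ eigenKer S† z ↔ S† f = z • (f : H) :=
  sub_eq_zero

/-- Otherwise `f` would be an eigenvector of `S† ↾ ker Γ₀` at a point of its resolvent set. This
makes the `γ`-field single-valued. -/
theorem eq_zero_of_mem_eigenKer {z : ℂ} (hz : z ∈ resolventSet bt.baseExtension)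
    {f : S†.domain} (hf : f ∈ eigenKer S† z) (h0 : bt.Γ₀ f = 0) : f = 0 := by
  have h : resolvent bt.baseExtension z 0 = (f : H) := by
    rw [resolvent_apply_eq_iff hz, zero_add]
    exact bt.mem_graph_baseExtension.2 ⟨f, h0, rfl, mem_eigenKer.1 hf⟩
  exact Subtype.ext (h.symm.trans (map_zero _))

theorem mem_graph_weylM {z : ℂ} (hz : z ∈ resolventSet bt.baseExtension) {x y : G} :
    (x, y) ∈ (bt.weylM z).graph ↔ ∃ f ∈ eigenKer S† z, bt.Γ₀ f = x ∧ bt.Γ₁ f = y := by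
  have hker : LinearMap.ker (bt.Γ₀.toPMap (eigenKer S† z)).toFun = ⊥ := by
    rw [LinearMap.ker_eq_bot']
    exact fun f hf => Subtype.ext (bt.eq_zero_of_mem_eigenKer hz f.2 hf)
  have hgraph : ∀ f : S†.domain, (x, f) ∈ (bt.gammaField z).graph ↔
      f ∈ eigenKer S† z ∧ bt.Γ₀ f = x := by
    intro f
    rw [gammaField, LinearPMap.inverse_graph hker]
    constructor
    · rintro ⟨⟨a, b⟩, hab, h⟩
      obtain ⟨g, hg, hg'⟩ := (LinearPMap.mem_graph_iff _).1 hab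
      obtain ⟨rfl, rfl⟩ := Prod.mk.inj h
      dsimp only at hg hg'
      rw [← hg, ← hg']
      exact ⟨g.2, rfl⟩
    · rintro ⟨hf, rfl⟩
      exact ⟨(f, bt.Γ₀ f), (bt.Γ₀.toPMap (eigenKer S† z)).mem_graph ⟨f, hf⟩, rfl⟩
  constructor
  · intro h
    obtain ⟨x', hx, rfl⟩ := (LinearPMap.mem_graph_iff _).1 h
    obtain rfl : (x' : G) = x := hx
    obtain ⟨h1, h2⟩ := (hgraph _).1 ((bt.gammaField z).mem_graph x')
    exact ⟨_, h1, h2, rfl⟩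
  · rintro ⟨f, hf, hx, rfl⟩
    obtain ⟨x', hx', hf'⟩ := (LinearPMap.mem_graph_iff _).1 ((hgraph f).2 ⟨hf, hx⟩)
    obtain rfl : (x' : G) = x := hx'
    obtain rfl : bt.gammaField z x' = f := hf'
    exact (bt.weylM z).mem_graph x'

section Lift

variable {A : H →ₗ.[ℂ] H} {w : ℂ}

/-- The resolvent of a restriction of `S†`, as a map into the domain of `S†`. -/
def resolventLift (hA : A ≤ S†) (hw : w ∈ resolventSet A) : H →ₗ[ℂ] S†.domain :=
  (resolvent A w : H →ₗ[ℂ] H).codRestrict S†.domain fun y =>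
    hA.1 (LinearPMap.mem_domain_of_mem_graph (resolvent_mem_graph hw y))

theorem coe_resolventLift (hA : A ≤ S†) (hw : w ∈ resolventSet A) (y : H) :
    (resolventLift hA hw y : H) = resolvent A w y := rfl

theorem adjoint_resolventLift (hA : A ≤ S†) (hw : w ∈ resolventSet A) (y : H) :
    S† (resolventLift hA hw y) = y + w • resolvent A w y := by
  have h := LinearPMap.le_graph_of_le hA (resolvent_mem_graph hw y)
  exact LinearPMap.mem_graph_snd_inj _ (S†.mem_graph _) h rfl

/-- Green's identity against `g` with boundary values `(0, u)` isolates the pairing of `u` with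
`Γ₀`, and the other side depends on the argument only through bounded operators. -/
theorem continuous_Γ₀_resolventLift [CompleteSpace G] (hA : A ≤ S†) (hw : w ∈ resolventSet A) :
    Continuous (bt.Γ₀ ∘ₗ resolventLift hA hw) := by
  refine continuous_of_forall_exists_inner_eq _ fun u => ?_
  obtain ⟨g, hg⟩ := bt.surjective (0, u)
  obtain ⟨h0, h1⟩ := Prod.mk.inj hg
  refine ⟨ContinuousLinearMap.adjoint (resolvent A w) (S† g - star w • (g : H)) - g, fun x => ?_⟩
  have h := bt.green (resolventLift hA hw x) g
  rw [h0, h1, inner_zero_left, zero_sub, adjoint_resolventLift, coe_resolventLift] at h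
  rw [LinearMap.comp_apply, ← neg_inj, ← h, inner_sub_left, ContinuousLinearMap.adjoint_inner_left,
    inner_sub_left, inner_smul_left, inner_add_right, inner_smul_right]
  simp
  ring

theorem continuous_Γ₁_resolventLift [CompleteSpace G] (hA : A ≤ S†) (hw : w ∈ resolventSet A) :
    Continuous (bt.Γ₁ ∘ₗ resolventLift hA hw) := by
  refine continuous_of_forall_exists_inner_eq _ fun u => ?_
  obtain ⟨g, hg⟩ := bt.surjective (u, 0)
  obtain ⟨h0, h1⟩ := Prod.mk.inj hg
  refine ⟨g - ContinuousLinearMap.adjoint (resolvent A w) (S† g - star w • (g : H)), fun x => ?_⟩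
  have h := bt.green (resolventLift hA hw x) g
  rw [h0, h1, inner_zero_left, sub_zero, adjoint_resolventLift, coe_resolventLift] at h
  rw [LinearMap.comp_apply, ← h, inner_sub_left, ContinuousLinearMap.adjoint_inner_left,
    inner_sub_left, inner_smul_left, inner_add_right, inner_smul_right]
  simp
  ring

end Lift

theorem baseExtension_le : bt.baseExtension ≤ S† := LinearPMap.domRestrict_le

theorem extension_le (Θ : G →ₗ.[ℂ] G) : bt.extension Θ ≤ S† := LinearPMap.domRestrict_le

variable [CompleteSpace G]

/-- A Krein type formula: the inverse of `Θ - M(z)` in terms of the resolvents of the extension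
belonging to `Θ`, and bounded operators that do not depend on `z`. -/
theorem exists_isBoundedInverse_sub_weylM {Θ : G →ₗ.[ℂ] G} {w : ℂ}
    (hwA : w ∈ resolventSet bt.baseExtension) (hwB : w ∈ resolventSet (bt.extension Θ)) :
    ∃ (K : H →L[ℂ] G) (C : G →L[ℂ] H), ∀ z ∈ resolventSet bt.baseExtension,
      z ∈ resolventSet (bt.extension Θ) → IsBoundedInverse (Θ - bt.weylM z)
        (K ∘L (1 + (z - w) • resolvent (bt.extension Θ) z) ∘L
          (1 - (z - w) • resolvent bt.baseExtension w) ∘L C) := by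
  let liftA := resolventLift bt.baseExtension_le hwA
  let K : H →L[ℂ] G := ⟨bt.Γ₀ ∘ₗ resolventLift (bt.extension_le Θ) hwB,
    bt.continuous_Γ₀_resolventLift _ hwB⟩
  let L : H →L[ℂ] G := ⟨bt.Γ₁ ∘ₗ liftA, bt.continuous_Γ₁_resolventLift _ hwA⟩
  have hΓ₀A : ∀ y, bt.Γ₀ (liftA y) = 0 := by
    intro y
    obtain ⟨f, hf, hfx, -⟩ := bt.mem_graph_baseExtension.1 (resolvent_mem_graph hwA y)
    obtain rfl : f = liftA y := Subtype.ext hfx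
    exact hf
  -- Any `f` with boundary values `(0, u)` lies in the domain of the base extension, so it is the
  -- resolvent at `w` of `(S† - w) f`.
  have hL : Function.Surjective L := by
    intro u
    obtain ⟨f, hf⟩ := bt.surjective (0, u)
    obtain ⟨h0, h1⟩ := Prod.mk.inj hf
    refine ⟨S† f - w • (f : H), ?_⟩
    have : liftA (S† f - w • (f : H)) = f := by
      refine Subtype.ext ((resolvent_apply_eq_iff hwA).2 ?_)
      rw [sub_add_cancel]
      exact bt.mem_graph_baseExtension.2 ⟨f, h0, rfl, rfl⟩
    change bt.Γ₁ (liftA _) = u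
    rw [this, h1]
  obtain ⟨C, hC⟩ := exists_rightInverse_of_surjective L hL
  refine ⟨K, C, fun z hzA hzB x y => ?_⟩
  set e : S†.domain := liftA (C y) with he
  have he0 : bt.Γ₀ e = 0 := hΓ₀A _
  have he1 : bt.Γ₁ e = y := hC y
  -- `h` is `(S† - z) e`, rewritten with the resolvent at the fixed point `w`.
  set h : H := C y - (z - w) • resolvent bt.baseExtension w (C y) with hh
  have heh : S† e = h + z • (e : H) := by
    rw [he, adjoint_resolventLift, coe_resolventLift, hh]
    module
  set k : S†.domain := resolventLift (bt.extension_le Θ) hzB h with hk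
  have hkS : S† k = h + z • (k : H) := adjoint_resolventLift _ hzB h
  have hkΘ : (bt.Γ₀ k, bt.Γ₁ k) ∈ Θ.graph := by
    obtain ⟨f, hf, hfx, -⟩ := bt.mem_graph_extension.1 (resolvent_mem_graph hzB h)
    obtain rfl : f = k := Subtype.ext hfx
    exact hf
  have hval : (K ∘L (1 + (z - w) • resolvent (bt.extension Θ) z) ∘L
      (1 - (z - w) • resolvent bt.baseExtension w) ∘L C) y = bt.Γ₀ k := by
    -- `Γ₀` is controlled only after a resolvent at the fixed `w`; the resolvent identity brings `k`
    -- into that form.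
    change bt.Γ₀ (resolventLift (bt.extension_le Θ) hwB
      (h + (z - w) • resolvent (bt.extension Θ) z h)) = _
    congr 1
    exact Subtype.ext (resolvent_apply_add_smul hzB hwB h)
  rw [hval, mem_graph_sub_iff]
  constructor
  · rintro ⟨a, b, ha, hb, hab⟩
    obtain ⟨f, hf, rfl, rfl⟩ := (bt.mem_graph_weylM hzA).1 hb
    have hfe : resolvent (bt.extension Θ) z h = ((f + e : S†.domain) : H) := by
      rw [resolvent_apply_eq_iff hzB]
      refine bt.mem_graph_extension.2 ⟨f + e, ?_, rfl, ?_⟩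
      · rw [map_add, map_add, he0, he1, add_zero, ← hab, add_sub_cancel]
        exact ha
      · rw [LinearPMap.map_add, mem_eigenKer.1 hf, heh, Submodule.coe_add]
        module
    have : k = f + e := Subtype.ext hfe
    rw [this, map_add, he0, add_zero]
  · rintro rfl
    refine ⟨_, _, hkΘ, (bt.mem_graph_weylM hzA).2 ⟨k - e, ?_, ?_, rfl⟩, ?_⟩
    · rw [mem_eigenKer, LinearPMap.map_sub, hkS, heh, Submodule.coe_sub]
      module
    · rw [map_sub, he0, sub_zero]
    · rw [map_sub, he1, sub_sub_cancel]

theorem exists_inverse_sub_weylM {Θ : G →ₗ.[ℂ] G} {z₀ : ℂ}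
    (hA : z₀ ∈ discreteSpectrum bt.baseExtension ∪ resolventSet bt.baseExtension)
    (hB : z₀ ∈ discreteSpectrum (bt.extension Θ) ∪ resolventSet (bt.extension Θ)) :
    (∀ᶠ z in 𝓝[≠] z₀, BoundedlyInvertible (Θ - bt.weylM z) ∧
      AnalyticAt ℂ (fun z => boundedInverse (Θ - bt.weylM z)) z) ∧
    MeromorphicAt (fun z => boundedInverse (Θ - bt.weylM z)) z₀ ∧
    FinitelyMeromorphicAt (fun z => boundedInverse (Θ - bt.weylM z)) z₀ := by
  have hev := (eventually_mem_resolventSet hA).and (eventually_mem_resolventSet hB)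
  obtain ⟨w, hwA, hwB⟩ := hev.exists
  obtain ⟨K, C, hKC⟩ := bt.exists_isBoundedInverse_sub_weylM hwA hwB
  obtain ⟨V, _, m, Q, hm, hQ, hR⟩ := exists_resolvent_eq hB
  let ℓ : ℂ → G →L[ℂ] H := fun z => (1 - (z - w) • resolvent bt.baseExtension w) ∘L C
  have hsc : ∀ z : ℂ, AnalyticAt ℂ (fun z : ℂ => z - w) z := fun z =>
    analyticAt_id.sub analyticAt_const
  have hℓ : ∀ z : ℂ, AnalyticAt ℂ ℓ z := fun z =>
    (analyticAt_const.sub ((hsc z).smul analyticAt_const)).clm_comp analyticAt_const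
  constructor
  · have hopen : IsOpen (resolventSet bt.baseExtension ∩ resolventSet (bt.extension Θ)) :=
      (isOpen_resolventSet _).inter (isOpen_resolventSet _)
    filter_upwards [hev] with z hz
    refine ⟨⟨_, hKC z hz.1 hz.2⟩, ?_⟩
    have h1 : AnalyticAt ℂ (fun z => 1 + (z - w) • resolvent (bt.extension Θ) z) z :=
      analyticAt_const.add ((hsc z).smul (analyticAt_resolvent hz.2))
    refine (analyticAt_const.clm_comp (h1.clm_comp (hℓ z)) :
      AnalyticAt ℂ (fun z => K ∘L (1 + (z - w) • resolvent (bt.extension Θ) z) ∘L ℓ z) z).congr ?_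
    filter_upwards [hopen.mem_nhds hz] with ζ hζ
    exact (hKC ζ hζ.1 hζ.2).boundedInverse_eq.symm
  -- Only the part of the resolvent with values in `V` can be singular, and it enters through the
  -- fixed finite rank map `K ∘L V.subtypeL`.
  · have hm' : MeromorphicAt (fun z => m z ∘L ((z - w) • ℓ z)) z₀ :=
      hm.clm_comp ((hsc z₀).smul (hℓ z₀)).meromorphicAt
    have hQ' : AnalyticAt ℂ (fun z => K ∘L ((1 + (z - w) • Q z) ∘L ℓ z)) z₀ :=
      analyticAt_const.clm_comp ((analyticAt_const.add ((hsc z₀).smul hQ)).clm_comp (hℓ z₀))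
    have hF : ∀ᶠ z in 𝓝[≠] z₀, boundedInverse (Θ - bt.weylM z) =
        (K ∘L V.subtypeL) ∘L (m z ∘L ((z - w) • ℓ z)) + K ∘L ((1 + (z - w) • Q z) ∘L ℓ z) := by
      filter_upwards [hev, hR] with z hz hRz
      rw [(hKC z hz.1 hz.2).boundedInverse_eq, hRz]
      ext y
      change K (ℓ z y + (z - w) • ((m z (ℓ z y) : H) + Q z (ℓ z y))) =
        K ((m z ((z - w) • ℓ z y) : V) : H) + K (ℓ z y + (z - w) • Q z (ℓ z y))
      rw [← map_add, map_smul, Submodule.coe_smul]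
      congr 1
      module
    refine ⟨?_, finitelyMeromorphicAt_of_eventuallyEq (K ∘L V.subtypeL) hm' hQ' hF⟩
    refine (((MeromorphicAt.const (K ∘L V.subtypeL) z₀).clm_comp hm').add hQ'.meromorphicAt).congr ?_
    filter_upwards [hF] with z hz using hz.symm

end BoundaryTriple

end Triples

end WeylExt

end

theorem proposition4p7
    {H : Type*} [NormedAddCommGroup H] [InnerProductSpace ℂ H] [CompleteSpace H]
    [TopologicalSpace.SeparableSpace H]
    {G : Type*} [NormedAddCommGroup G] [InnerProductSpace ℂ G] [CompleteSpace G]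
    (B : Fin 2 → H →ₗ.[ℂ] H) (S A₀ : H →ₗ.[ℂ] H)
    (hset : WeylExt.Setting B S A₀)
    (bt : WeylExt.BoundaryTriple S G)
    (hA₀ : A₀ = bt.baseExtension)
    (Θ : Fin 2 → G →ₗ.[ℂ] G)
    (hΘ_dense : ∀ j, Dense ((Θ j).domain : Set G))
    (hΘ_closed : ∀ j, (Θ j).IsClosed)
    (hB : ∀ j, B j = bt.extension (Θ j))
    (hB_adjoint : ∀ j, (B j).adjoint = bt.extension (Θ j).adjoint)
    (z₀ : ℂ)
    (hz₀_B : ∀ j, z₀ ∈ WeylExt.discreteSpectrum (B j) ∪ WeylExt.resolventSet (B j))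
    (hz₀_A₀ : z₀ ∈ WeylExt.discreteSpectrum A₀ ∪ WeylExt.resolventSet A₀) :
    ∃ ε₀ : ℝ, 0 < ε₀ ∧
      Metric.ball z₀ ε₀ \ {z₀} ⊆ WeylExt.resolventSet A₀ ∧
      ∀ j,
        (∀ z ∈ Metric.ball z₀ ε₀ \ {z₀}, WeylExt.BoundedlyInvertible (Θ j - bt.weylM z)) ∧
        AnalyticOnNhd ℂ (fun z => WeylExt.boundedInverse (Θ j - bt.weylM z))
          (Metric.ball z₀ ε₀ \ {z₀}) ∧
        WeylExt.FinitelyMeromorphicOn (fun z => WeylExt.boundedInverse (Θ j - bt.weylM z))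
          (Metric.ball z₀ ε₀) := by
  obtain rfl : B = fun j => bt.extension (Θ j) := funext hB
  subst hA₀
  have h := fun j => bt.exists_inverse_sub_weylM hz₀_A₀ (hz₀_B j)
  obtain ⟨ε, hε, hball⟩ := Metric.eventually_nhds_iff_ball.1 (eventually_nhdsWithin_iff.1
    ((WeylExt.eventually_mem_resolventSet hz₀_A₀).and
      (Filter.eventually_all.2 fun j => (h j).1)))
  refine ⟨ε, hε, fun z hz => (hball z hz.1 hz.2).1, fun j =>
    ⟨fun z hz => ((hball z hz.1 hz.2).2 j).1, fun z hz => ((hball z hz.1 hz.2).2 j).2, ?_, ?_⟩⟩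
  · intro z hz
    rcases eq_or_ne z z₀ with rfl | hne
    · exact (h j).2.1
    · exact ((hball z hz hne).2 j).2.meromorphicAt
  · intro z hz hord
    rcases eq_or_ne z z₀ with rfl | hne
    · exact (h j).2.2
    -- Away from `z₀` the function is analytic, so `z₀` is the only possible pole.
    · exact absurd hord ((hball z hz hne).2 j).2.meromorphicOrderAt_nonneg.not_gt
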